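/- **Continuity of the nested Average Value-at-Risk.** Let $T\in\mathbb N$, let $\Xi_1,\dots,\Xi_T$ be nonempty Polish spaces, and let $\Xi=\Xi_1\times\dots\times\Xi_T$ carry a metric $d$ that induces the product topology. Write $x_{1:t}=(x_1,\dots,x_t)$, with $x_{1:0}=()$ the empty tuple. For a Borel probability measure $P$ on $\Xi$ let $P_t(\cdot\mid x_{1:t-1})$ denote the regular conditional distribution under $P$ of the $t$-th coordinate given the first $t-1$ coordinates. *Nested Average Value-at-Risk.* For a probability measure $\mu$ and $\alpha\in[0,1)$ put $$\mathrm{AVaR}_{\alpha;\mu}(Y)=\inf_{q\in\mathbb R}\Bigl\{q+\tfrac1{1-\alpha}\,\mathbb E_\mu (Y-q)_+\Bigr\},$$ and $\mathrm{AVaR}_{1;\mu}(Y)=\operatorname{ess\,sup}_\mu Y$. For $\alpha_1,\dots,\alpha_T\in[0,1]$ and $Y\in L^1(P)$ set $Y_T=Y$ and, for $t=T,\dots,1$, $$Y_{t-1}(x_{1:t-1})=\mathrm{AVaR}_{\alpha_t;\,P_t(\cdot\mid x_{1:t-1})}\bigl(\xi\mapsto Y_t(x_{1:t-1},\xi)\bigr),\qquad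 \mathrm{nAVaR}_{\alpha_{1:T};P}(Y):=Y_0 .$$ *Nested distance.* Let $r\in[1,\infty)$. For a cost function $c\ge 0$ let $w_r(\mu,\nu;c)=\inf_\pi\bigl(\int c^r\,\mathrm d\pi\bigr)^{1/r}\in[0,\infty]$, the infimum being over all probability measures $\pi$ with marginals $\mu$ and $\nu$. For Borel probability measures $P,\tilde P$ on $\Xi$ set $c_T=d$ and, for $t=T,\dots,1$, $$c_{t-1}(x_{1:t-1},y_{1:t-1})=w_r\Bigl(P_t(\cdot\mid x_{1:t-1}),\tilde P_t(\cdot\mid y_{1:t-1});\ (\xi,\eta)\mapsto c_t\bigl((x_{1:t-1},\xi),(y_{1:t-1},\eta)\bigr)\Bigr),\qquad \mathrm{nd}_r(P,\tilde P):=c_0\in[0,\infty].$$ **Statement.** Let $P,\tilde P$ be Borel probability measures on $\Xi$, let $L\ge0$, and let $Y\colon\Xi\to\mathbb R$ satisfy $|Y(x)-Y(y)|\le L\,d(x,y)$ for all $x,y\in\Xi$ and be integrable with respect to both $P$ and $\tilde P$. Let $\alpha_1,\dots,\alpha_T\in[0,1]$ and let $\alpha<1$ satisfy $\alpha\ge 1-\prod_{t=1}^T(1-\alpha_t)$.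 Then, for every $r\in[1,\infty)$, $$\bigl|\mathrm{nAVaR}_{\alpha_{1:T};P}(Y)-\mathrm{nAVaR}_{\alpha_{1:T};\tilde P}(Y)\bigr|\le\frac{L}{1-\alpha}\,\mathrm{nd}_r(P,\tilde P)$$ (with the convention $0\cdot\infty=0$ on the right). -/

import Mathlib

open MeasureTheory ProbabilityTheory
open scoped ENNReal

universe u

/-- The Average Value-at-Risk of `Y` at level `α` under the probability measure `μ`:
`inf_q (q + E (Y - q)₊ / (1 - α))` for `α < 1`, and the essential supremum (for bounded `Y`) for `α = 1`. -/
noncomputable def AVaR {X : Type*} [MeasurableSpace X] (α : ℝ) (μ : Measure X) (Y : X → ℝ) : ℝ :=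
  open Classical in
  if α = 1 then essSup Y μ
  else ⨅ q : ℝ, (q + 1 / (1 - α) * ∫ x, max (Y x - q) 0 ∂μ)

/-- The Wasserstein distance of order `r` between `μ` and `ν` for the cost function `c`:
the infimum of `(E_π c ^ r) ^ (1 / r)` over all measures `π` with marginals `μ` and `ν`. -/
noncomputable def wasserstein {X : Type*} [MeasurableSpace X] (r : ℝ) (c : X → X → ℝ≥0∞)
    (μ ν : Measure X) : ℝ≥0∞ :=
  ⨅ (π : Measure (X × X)) (_ : π.fst = μ ∧ π.snd = ν),
    (∫⁻ z, c z.1 z.2 ^ r ∂π) ^ (1 / r)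

/-- The marginal on the first `n` of `n + 1` stages. -/
noncomputable def initMarginal {n : ℕ} {Ξ : Fin (n + 1) → Type u} [∀ t, MeasurableSpace (Ξ t)]
    (P : Measure (∀ t, Ξ t)) : Measure (∀ t : Fin n, Ξ t.castSucc) :=
  P.map (fun x t => x t.castSucc)

instance initMarginal_isFiniteMeasure {n : ℕ} {Ξ : Fin (n + 1) → Type u} [∀ t, MeasurableSpace (Ξ t)]
    (P : Measure (∀ t, Ξ t)) [IsFiniteMeasure P] : IsFiniteMeasure (initMarginal P) := by
  unfold initMarginal; infer_instance

/-- The regular conditional distribution of the last stage given the history of all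
previous stages. -/
noncomputable def lastKernel {n : ℕ} {Ξ : Fin (n + 1) → Type u} [∀ t, MeasurableSpace (Ξ t)]
    [∀ t, StandardBorelSpace (Ξ t)] [∀ t, Nonempty (Ξ t)]
    (P : Measure (∀ t, Ξ t)) [IsFiniteMeasure P] :
    Kernel (∀ t : Fin n, Ξ t.castSucc) (Ξ (Fin.last n)) :=
  condDistrib (fun x : ∀ t, Ξ t => x (Fin.last n)) (fun x (t : Fin n) => x t.castSucc) P

/-- The nested Average Value-at-Risk: the innermost `AVaR` is taken with respect to the
conditional distribution of the last stage given the history; what results is a random variable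
on the previous stages, to which the construction is applied again. With no stage left it is a
number, the value at the empty tuple. -/
noncomputable def nestedAVaR : {T : ℕ} → {Ξ : Fin T → Type u} → [∀ t, MeasurableSpace (Ξ t)] →
    [∀ t, StandardBorelSpace (Ξ t)] → [∀ t, Nonempty (Ξ t)] →
    (α : Fin T → ℝ) → (P : Measure (∀ t, Ξ t)) → [IsFiniteMeasure P] →
    (Y : (∀ t, Ξ t) → ℝ) → ℝ
  | 0, _, _, _, _, _, _, _, Y => Y (fun t => t.elim0)
  | n + 1, Ξ, _, _, _, α, P, _, Y =>
    nestedAVaR (Ξ := fun t : Fin n => Ξ t.castSucc) (fun t => α t.castSucc) (initMarginal P)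
      (fun x => AVaR (α (Fin.last n)) (lastKernel P x) (fun ξ => Y (Fin.snoc (α := Ξ) x ξ)))

/-- The initial value `c₀` of the cost process of order `r` with terminal cost `c_T = c` and
`c_{t-1}(x, y) = w_r (P_t(· | x_{1:t-1}), Q_t(· | y_{1:t-1}); c_t)`. -/
noncomputable def nestedCost (r : ℝ) : {T : ℕ} → {Ξ : Fin T → Type u} →
    [∀ t, MeasurableSpace (Ξ t)] → [∀ t, StandardBorelSpace (Ξ t)] → [∀ t, Nonempty (Ξ t)] →
    (c : (∀ t, Ξ t) → (∀ t, Ξ t) → ℝ≥0∞) →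
    (P Q : Measure (∀ t, Ξ t)) → [IsFiniteMeasure P] → [IsFiniteMeasure Q] → ℝ≥0∞
  | 0, _, _, _, _, c, _, _, _, _ => c (fun t => t.elim0) (fun t => t.elim0)
  | n + 1, Ξ, _, _, _, c, P, Q, _, _ =>
    nestedCost r (Ξ := fun t : Fin n => Ξ t.castSucc)
      (fun x y => wasserstein r
        (fun ξ η => c (Fin.snoc (α := Ξ) x ξ) (Fin.snoc (α := Ξ) y η))
        (lastKernel P x) (lastKernel Q y))
      (initMarginal P) (initMarginal Q)

/-- The nested distance of order `r` with respect to the distance `d` on the path space. -/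
noncomputable def nestedDist {T : ℕ} {Ξ : Fin T → Type u} [∀ t, MeasurableSpace (Ξ t)]
    [∀ t, StandardBorelSpace (Ξ t)] [∀ t, Nonempty (Ξ t)]
    (r : ℝ) (d : (∀ t, Ξ t) → (∀ t, Ξ t) → ℝ)
    (P Q : Measure (∀ t, Ξ t)) [IsFiniteMeasure P] [IsFiniteMeasure Q] : ℝ≥0∞ :=
  nestedCost r (fun x y => ENNReal.ofReal (d x y)) P Q

/-!
For a coupling `π` of `μ` and `ν`, both Average Values-at-Risk can be computed under `π`, and
`AVaR α` is Lipschitz on `L¹(π)` with constant `1 / (1 - α)`. Minimising over `π` and using that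
the Wasserstein distances increase with the order, a bound `|Y - Z| ≤ K c` turns into
`|AVaR Y - AVaR Z| ≤ K / (1 - α) w_r(c)`. The right-hand side is again a multiple of a cost, one
stage earlier, so the constants `1 / (1 - α_t)` multiply up from the last stage to the first.
Conditional distributions are only determined almost everywhere, which is why the bound
`|Y - Z| ≤ K c` is propagated along the product of the filters of almost everywhere sets.
-/

open Filter

section AverageValueAtRisk

variable {X : Type*} [MeasurableSpace X] {μ : Measure X} {α : ℝ} {f g : X → ℝ}

/-- The Rockafellar–Uryasev functional `q ↦ q + E (f - q)₊ / (1 - α)`, whose infimum over `q` is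
the Average Value-at-Risk at a level `α ≠ 1`. -/
noncomputable def rockafellarUryasev (α : ℝ) (μ : Measure X) (f : X → ℝ) (q : ℝ) : ℝ :=
  q + 1 / (1 - α) * ∫ x, max (f x - q) 0 ∂μ

lemma AVaR_eq_iInf (hα : α ≠ 1) : AVaR α μ f = ⨅ q, rockafellarUryasev α μ f q :=
  if_neg hα

lemma integrable_max_sub_zero [IsFiniteMeasure μ] (hf : Integrable f μ) (q : ℝ) :
    Integrable (fun x => max (f x - q) 0) μ :=
  (hf.sub (integrable_const q)).pos_part

lemma continuous_rockafellarUryasev [IsFiniteMeasure μ] (hf : Integrable f μ) :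
    Continuous (rockafellarUryasev α μ f) := by
  have hlip : ∀ p q, dist (∫ x, max (f x - p) 0 ∂μ) (∫ x, max (f x - q) 0 ∂μ)
      ≤ μ.real Set.univ * dist p q := fun p q => by
    rw [dist_eq_norm, mul_comm,
      ← integral_sub (integrable_max_sub_zero hf p) (integrable_max_sub_zero hf q)]
    refine norm_integral_le_of_norm_le_const (.of_forall fun x => ?_)
    refine (abs_max_sub_max_le_abs _ _ _).trans_eq ?_
    rw [sub_sub_sub_cancel_left, abs_sub_comm, Real.dist_eq]
  exact continuous_id.add (continuous_const.mul (LipschitzWith.of_dist_le' hlip).continuous)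

lemma AVaR_eq_iInf_rat [IsFiniteMeasure μ] (hα : α ≠ 1) (hf : Integrable f μ) :
    AVaR α μ f = ⨅ q : ℚ, rockafellarUryasev α μ f q := by
  have hdense : Dense (Set.range ((↑) : ℚ → ℝ)) := Rat.denseRange_cast
  rw [AVaR_eq_iInf hα, ← hdense.ciInf' (continuous_rockafellarUryasev hf), iInf_range']

lemma AVaR_map {Z : Type*} [MeasurableSpace Z] (hα : α ≠ 1) {φ : X → Z} (hφ : AEMeasurable φ μ)
    {h : Z → ℝ} (hh : AEMeasurable h (μ.map φ)) :
    AVaR α (μ.map φ) h = AVaR α μ (h ∘ φ) := by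
  simp only [AVaR_eq_iInf hα, rockafellarUryasev]
  congr! 4 with q
  exact integral_map hφ ((hh.sub_const q).max aemeasurable_const).aestronglyMeasurable

lemma rockafellarUryasev_le_add [IsFiniteMeasure μ] (hα : α < 1) (hf : Integrable f μ)
    (hg : Integrable g μ) (q : ℝ) :
    rockafellarUryasev α μ f q
      ≤ rockafellarUryasev α μ g q + 1 / (1 - α) * ∫ x, |f x - g x| ∂μ := by
  have hfg : Integrable (fun x => |f x - g x|) μ := (hf.sub hg).abs
  have hpos : 0 ≤ 1 / (1 - α) := one_div_nonneg.2 (sub_nonneg.2 hα.le)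
  rw [rockafellarUryasev, rockafellarUryasev, add_assoc, ← mul_add,
    ← integral_add (integrable_max_sub_zero hg q) hfg]
  refine add_le_add le_rfl (mul_le_mul_of_nonneg_left (integral_mono
    (integrable_max_sub_zero hf q) ((integrable_max_sub_zero hg q).add hfg) fun x => ?_) hpos)
  have hlip := (le_abs_self _).trans (abs_max_sub_max_le_abs (f x - q) (g x - q) 0)
  rw [sub_sub_sub_cancel_right] at hlip
  exact sub_le_iff_le_add'.1 hlip

section IsProbabilityMeasure

variable [IsProbabilityMeasure μ] (hα0 : 0 ≤ α) (hα1 : α < 1)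
include hα0 hα1

lemma integral_le_rockafellarUryasev (hf : Integrable f μ) (q : ℝ) :
    ∫ x, f x ∂μ ≤ rockafellarUryasev α μ f q := by
  have hconst : 1 ≤ 1 / (1 - α) := one_le_one_div (by linarith) (by linarith)
  calc ∫ x, f x ∂μ
      = q + ∫ x, (f x - q) ∂μ := by
        rw [integral_sub hf (integrable_const q), integral_const, probReal_univ, one_smul,
          add_sub_cancel]
    _ ≤ q + ∫ x, max (f x - q) 0 ∂μ := by
        gcongr
        · exact hf.sub (integrable_const q)
        · exact integrable_max_sub_zero hf q
        · exact fun x => le_max_left _ _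
    _ ≤ rockafellarUryasev α μ f q :=
        add_le_add le_rfl
          (le_mul_of_one_le_left (integral_nonneg fun x => le_max_right _ _) hconst)

lemma AVaR_le_rockafellarUryasev (hf : Integrable f μ) (q : ℝ) :
    AVaR α μ f ≤ rockafellarUryasev α μ f q := by
  rw [AVaR_eq_iInf hα1.ne]
  refine ciInf_le ⟨∫ x, f x ∂μ, ?_⟩ q
  rintro _ ⟨p, rfl⟩
  exact integral_le_rockafellarUryasev hα0 hα1 hf p

lemma AVaR_const (b : ℝ) : AVaR α μ (fun _ => b) = b := by
  refine le_antisymm ?_ ?_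
  · simpa [rockafellarUryasev] using
      AVaR_le_rockafellarUryasev (μ := μ) hα0 hα1 (integrable_const b) b
  · rw [AVaR_eq_iInf hα1.ne]
    exact le_ciInf fun q => by
      simpa using integral_le_rockafellarUryasev (μ := μ) hα0 hα1 (integrable_const b) q

lemma AVaR_sub_le (hf : Integrable f μ) (hg : Integrable g μ) :
    AVaR α μ f - AVaR α μ g ≤ 1 / (1 - α) * ∫ x, |f x - g x| ∂μ := by
  rw [sub_le_comm, AVaR_eq_iInf hα1.ne (f := g)]
  exact le_ciInf fun q => sub_le_iff_le_add.2 <|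
    (AVaR_le_rockafellarUryasev hα0 hα1 hf q).trans (rockafellarUryasev_le_add hα1 hf hg q)

lemma abs_AVaR_sub_le (hf : Integrable f μ) (hg : Integrable g μ) :
    |AVaR α μ f - AVaR α μ g| ≤ 1 / (1 - α) * ∫ x, |f x - g x| ∂μ := by
  refine abs_sub_le_iff.2 ⟨AVaR_sub_le hα0 hα1 hf hg, ?_⟩
  simpa only [abs_sub_comm] using AVaR_sub_le hα0 hα1 hg hf

lemma abs_AVaR_le (hf : Integrable f μ) :
    |AVaR α μ f| ≤ 1 / (1 - α) * ∫ x, |f x| ∂μ := by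
  simpa [AVaR_const hα0 hα1] using abs_AVaR_sub_le hα0 hα1 hf (integrable_const 0)

end IsProbabilityMeasure

lemma aestronglyMeasurable_AVaR_compProd {Z : Type*} [MeasurableSpace Z] [SFinite μ]
    {κ : Kernel X Z} [IsFiniteKernel κ] (hα : α ≠ 1) {h : X × Z → ℝ}
    (hh : Integrable h (μ ⊗ₘ κ)) :
    AEStronglyMeasurable (fun x => AVaR α (κ x) fun z => h (x, z)) μ := by
  have hslice := ((Measure.integrable_compProd_iff hh.aestronglyMeasurable).1 hh).1
  have hinf : AEMeasurable
      (fun x => ⨅ q : ℚ, rockafellarUryasev α (κ x) (fun z => h (x, z)) q) μ := by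
    refine .iInf fun q => ((AEMeasurable.const_mul ?_ _).const_add _)
    have hq : AEStronglyMeasurable (fun w => max (h w - q) 0) (μ ⊗ₘ κ) :=
      ((hh.aemeasurable.sub_const _).max aemeasurable_const).aestronglyMeasurable
    simpa using hq.integral_kernel_compProd.aemeasurable
  refine (hinf.congr ?_).aestronglyMeasurable
  filter_upwards [hslice] with x hx using (AVaR_eq_iInf_rat hα hx).symm

lemma integrable_AVaR_compProd {Z : Type*} [MeasurableSpace Z] [SFinite μ]
    {κ : Kernel X Z} [IsMarkovKernel κ] (hα0 : 0 ≤ α) (hα1 : α < 1) {h : X × Z → ℝ}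
    (hh : Integrable h (μ ⊗ₘ κ)) :
    Integrable (fun x => AVaR α (κ x) fun z => h (x, z)) μ := by
  obtain ⟨hslice, hnorm⟩ := (Measure.integrable_compProd_iff hh.aestronglyMeasurable).1 hh
  refine (hnorm.const_mul (1 / (1 - α))).mono' (aestronglyMeasurable_AVaR_compProd hα1.ne hh) ?_
  filter_upwards [hslice] with x hx using abs_AVaR_le hα0 hα1 hx

end AverageValueAtRisk

section Wasserstein

variable {X Z : Type*} [MeasurableSpace X] [MeasurableSpace Z] {μ ν : Measure X} {α : ℝ}

lemma lintegral_rpow_rpow_one_div_mono [IsProbabilityMeasure μ] {p q : ℝ} (hp : 0 < p)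
    (hpq : p ≤ q) (c : X → ℝ≥0∞) :
    (∫⁻ x, c x ^ p ∂μ) ^ (1 / p) ≤ (∫⁻ x, c x ^ q ∂μ) ^ (1 / q) := by
  -- Comparing the norms requires measurability, so `c ^ p` is replaced by a measurable minorant.
  obtain ⟨g, hg, hgc, hint⟩ := exists_measurable_le_lintegral_eq μ fun x => c x ^ p
  have hroot : ∀ x, (g x ^ (1 / p)) ^ p = g x := fun x => by
    rw [← ENNReal.rpow_mul, one_div_mul_cancel hp.ne', ENNReal.rpow_one]
  have hroot_le : ∀ x, g x ^ (1 / p) ≤ c x := fun x => by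
    rw [one_div]
    exact (ENNReal.rpow_inv_le_iff hp).2 (hgc x)
  calc (∫⁻ x, c x ^ p ∂μ) ^ (1 / p)
      = (∫⁻ x, (g x ^ (1 / p)) ^ p ∂μ) ^ (1 / p) := by simp only [hint, hroot]
    _ ≤ (∫⁻ x, (g x ^ (1 / p)) ^ q ∂μ) ^ (1 / q) := by
        simpa only [eLpNorm', enorm_eq_self] using
          eLpNorm'_le_eLpNorm'_of_exponent_le hp hpq μ
            (hg.pow_const (1 / p)).aestronglyMeasurable
    _ ≤ (∫⁻ x, c x ^ q ∂μ) ^ (1 / q) := by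
        have hq : 0 ≤ q := hp.le.trans hpq
        gcongr with x
        exact hroot_le x

lemma isProbabilityMeasure_of_fst (π : Measure (X × Z)) [IsProbabilityMeasure π.fst] :
    IsProbabilityMeasure π :=
  ⟨by rw [← Measure.fst_univ, measure_univ]⟩

lemma wasserstein_mono_order [IsProbabilityMeasure μ] {r s : ℝ} (hr : 0 < r) (hrs : r ≤ s)
    (c : X → X → ℝ≥0∞) : wasserstein r c μ ν ≤ wasserstein s c μ ν := by
  refine iInf₂_mono fun π hπ => ?_
  obtain ⟨rfl, -⟩ := hπ
  have := isProbabilityMeasure_of_fst π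
  exact lintegral_rpow_rpow_one_div_mono hr hrs _

lemma wasserstein_one (c : X → X → ℝ≥0∞) :
    wasserstein 1 c μ ν
      = ⨅ π : {π : Measure (X × X) // π.fst = μ ∧ π.snd = ν}, ∫⁻ z, c z.1 z.2 ∂π.1 := by
  simp only [wasserstein, iInf_subtype', ENNReal.rpow_one, one_div_one]

lemma ae_le_ae_fst_prod_ae_snd (π : Measure (X × Z)) : ae π ≤ ae π.fst ×ˢ ae π.snd :=
  (Measure.tendsto_ae_map measurable_fst.aemeasurable).prodMk
    (Measure.tendsto_ae_map measurable_snd.aemeasurable)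

lemma ofReal_abs_AVaR_sub_le_lintegral {π : Measure (X × Z)} [IsProbabilityMeasure π]
    (hα0 : 0 ≤ α) (hα1 : α < 1) {f : X → ℝ} {g : Z → ℝ} (hf : Integrable f π.fst)
    (hg : Integrable g π.snd) :
    ENNReal.ofReal |AVaR α π.fst f - AVaR α π.snd g|
      ≤ ENNReal.ofReal (1 / (1 - α)) * ∫⁻ z, ENNReal.ofReal |f z.1 - g z.2| ∂π := by
  have hf' : Integrable (fun z : X × Z => f z.1) π := hf.comp_measurable measurable_fst
  have hg' : Integrable (fun z : X × Z => g z.2) π := hg.comp_measurable measurable_snd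
  have hfst : AVaR α π.fst f = AVaR α π fun z => f z.1 :=
    AVaR_map hα1.ne measurable_fst.aemeasurable hf.aemeasurable
  have hsnd : AVaR α π.snd g = AVaR α π fun z => g z.2 :=
    AVaR_map hα1.ne measurable_snd.aemeasurable hg.aemeasurable
  have hfg : Integrable (fun z : X × Z => |f z.1 - g z.2|) π := (hf'.sub hg').abs
  rw [hfst, hsnd, ← ofReal_integral_eq_lintegral_ofReal hfg (.of_forall fun z => abs_nonneg _),
    ← ENNReal.ofReal_mul (by simpa using hα1.le)]
  exact ENNReal.ofReal_le_ofReal (abs_AVaR_sub_le hα0 hα1 hf' hg')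

lemma ofReal_abs_AVaR_sub_le_wasserstein_one [IsProbabilityMeasure μ] [IsProbabilityMeasure ν]
    (hα0 : 0 ≤ α) (hα1 : α < 1) {f g : X → ℝ} (hf : Integrable f μ) (hg : Integrable g ν) {K : ℝ}
    {c : X → X → ℝ≥0∞}
    (h : ∀ᶠ z in ae μ ×ˢ ae ν, ENNReal.ofReal |f z.1 - g z.2| ≤ ENNReal.ofReal K * c z.1 z.2) :
    ENNReal.ofReal |AVaR α μ f - AVaR α ν g|
      ≤ ENNReal.ofReal (K / (1 - α)) * wasserstein 1 c μ ν := by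
  have : Nonempty {π : Measure (X × X) // π.fst = μ ∧ π.snd = ν} :=
    ⟨μ.prod ν, Measure.fst_prod, Measure.snd_prod⟩
  rw [wasserstein_one, ENNReal.mul_iInf fun htop => absurd htop ENNReal.ofReal_ne_top]
  refine le_iInf ?_
  rintro ⟨π, rfl, rfl⟩
  have := isProbabilityMeasure_of_fst π
  calc ENNReal.ofReal |AVaR α π.fst f - AVaR α π.snd g|
      ≤ ENNReal.ofReal (1 / (1 - α)) * ∫⁻ z, ENNReal.ofReal |f z.1 - g z.2| ∂π :=
        ofReal_abs_AVaR_sub_le_lintegral hα0 hα1 hf hg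
    _ ≤ ENNReal.ofReal (1 / (1 - α)) * ∫⁻ z, ENNReal.ofReal K * c z.1 z.2 ∂π := by
        gcongr _ * ?_
        exact lintegral_mono_ae (ae_le_ae_fst_prod_ae_snd π h)
    _ = ENNReal.ofReal (K / (1 - α)) * ∫⁻ z, c z.1 z.2 ∂π := by
        rw [lintegral_const_mul' _ _ ENNReal.ofReal_ne_top, ← mul_assoc,
          ← ENNReal.ofReal_mul (by simpa using hα1.le), one_div_mul_eq_div]

lemma ofReal_abs_AVaR_sub_le_wasserstein [IsProbabilityMeasure μ] [IsProbabilityMeasure ν]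
    (hα0 : 0 ≤ α) (hα1 : α < 1) {r : ℝ} (hr : 1 ≤ r) {f g : X → ℝ} (hf : Integrable f μ)
    (hg : Integrable g ν) {K : ℝ} {c : X → X → ℝ≥0∞}
    (h : ∀ᶠ z in ae μ ×ˢ ae ν, ENNReal.ofReal |f z.1 - g z.2| ≤ ENNReal.ofReal K * c z.1 z.2) :
    ENNReal.ofReal |AVaR α μ f - AVaR α ν g|
      ≤ ENNReal.ofReal (K / (1 - α)) * wasserstein r c μ ν :=
  (ofReal_abs_AVaR_sub_le_wasserstein_one hα0 hα1 hf hg h).trans <|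
    mul_le_mul_right (wasserstein_mono_order one_pos hr c) _

end Wasserstein

section Disintegration

variable {n : ℕ} {Ξ : Fin (n + 1) → Type u} [∀ t, MeasurableSpace (Ξ t)]

lemma measurable_finInit : Measurable (fun (x : ∀ t, Ξ t) (t : Fin n) => x t.castSucc) :=
  measurable_pi_lambda _ fun _ => measurable_pi_apply _

lemma measurable_finSnoc :
    Measurable fun z : (∀ t : Fin n, Ξ t.castSucc) × Ξ (Fin.last n) =>
      Fin.snoc (α := Ξ) z.1 z.2 := by
  refine measurable_pi_lambda _ fun t => ?_
  induction t using Fin.lastCases with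
  | last => simpa only [Fin.snoc_last] using measurable_snd
  | cast t =>
    simp only [Fin.snoc_castSucc]
    exact (measurable_pi_apply t).comp measurable_fst

instance initMarginal_isProbabilityMeasure (P : Measure (∀ t, Ξ t)) [IsProbabilityMeasure P] :
    IsProbabilityMeasure (initMarginal P) :=
  Measure.isProbabilityMeasure_map measurable_finInit.aemeasurable

variable [∀ t, StandardBorelSpace (Ξ t)] [∀ t, Nonempty (Ξ t)] {P Q : Measure (∀ t, Ξ t)}
  [IsFiniteMeasure P] [IsFiniteMeasure Q]

instance lastKernel_isMarkovKernel : IsMarkovKernel (lastKernel P) := by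
  unfold lastKernel
  infer_instance

variable (P) in
lemma map_finSnoc_compProd :
    (initMarginal P ⊗ₘ lastKernel P).map (fun z => Fin.snoc (α := Ξ) z.1 z.2) = P := by
  have hlast : Measurable fun x : ∀ t, Ξ t => x (Fin.last n) := measurable_pi_apply _
  rw [initMarginal, lastKernel, compProd_map_condDistrib hlast.aemeasurable,
    Measure.map_map measurable_finSnoc (measurable_finInit.prodMk hlast)]
  convert Measure.map_id
  funext x
  exact Fin.snoc_init_self x

lemma integrable_comp_finSnoc {Y : (∀ t, Ξ t) → ℝ} (hY : Integrable Y P) :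
    Integrable (fun z => Y (Fin.snoc (α := Ξ) z.1 z.2)) (initMarginal P ⊗ₘ lastKernel P) := by
  rw [← map_finSnoc_compProd P] at hY
  exact hY.comp_measurable measurable_finSnoc

lemma ae_integrable_lastKernel {Y : (∀ t, Ξ t) → ℝ} (hY : Integrable Y P) :
    ∀ᵐ x ∂initMarginal P, Integrable (fun ξ => Y (Fin.snoc (α := Ξ) x ξ)) (lastKernel P x) :=
  have hY' := integrable_comp_finSnoc hY
  ((Measure.integrable_compProd_iff hY'.aestronglyMeasurable).1 hY').1

lemma integrable_AVaR_lastKernel {α : ℝ} (hα0 : 0 ≤ α) (hα1 : α < 1) {Y : (∀ t, Ξ t) → ℝ}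
    (hY : Integrable Y P) :
    Integrable (fun x => AVaR α (lastKernel P x) fun ξ => Y (Fin.snoc (α := Ξ) x ξ))
      (initMarginal P) :=
  integrable_AVaR_compProd (h := fun z => Y (Fin.snoc (α := Ξ) z.1 z.2)) hα0 hα1
    (integrable_comp_finSnoc hY)

lemma ae_ae_lastKernel {p : (∀ t, Ξ t) → Prop} (hp : ∀ᵐ x ∂P, p x) :
    ∀ᵐ x ∂initMarginal P, ∀ᵐ ξ ∂lastKernel P x, p (Fin.snoc (α := Ξ) x ξ) := by
  rw [← map_finSnoc_compProd P] at hp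
  exact Measure.ae_ae_of_ae_compProd (ae_of_ae_map measurable_finSnoc.aemeasurable hp)

lemma eventually_ae_prod_ae_lastKernel {p : (∀ t, Ξ t) × (∀ t, Ξ t) → Prop}
    (hp : ∀ᶠ z in ae P ×ˢ ae Q, p z) :
    ∀ᶠ z in ae (initMarginal P) ×ˢ ae (initMarginal Q),
      ∀ᶠ w in ae (lastKernel P z.1) ×ˢ ae (lastKernel Q z.2),
        p (Fin.snoc (α := Ξ) z.1 w.1, Fin.snoc (α := Ξ) z.2 w.2) := by
  obtain ⟨pP, hpP, pQ, hpQ, h⟩ := eventually_prod_iff.1 hp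
  filter_upwards [(ae_ae_lastKernel hpP).prod_mk (ae_ae_lastKernel hpQ)] with z hz
  filter_upwards [hz.1.prod_mk hz.2] with w hw using h hw.1 hw.2

end Disintegration

section NestedAVaR

variable {T : ℕ} {Ξ : Fin T → Type u} [∀ t, MeasurableSpace (Ξ t)]
  [∀ t, StandardBorelSpace (Ξ t)] [∀ t, Nonempty (Ξ t)] {P Q : Measure (∀ t, Ξ t)}
  [IsProbabilityMeasure P] [IsProbabilityMeasure Q] {Y Z : (∀ t, Ξ t) → ℝ}
  {c : (∀ t, Ξ t) → (∀ t, Ξ t) → ℝ≥0∞} {α : Fin T → ℝ} {L r : ℝ}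

theorem ofReal_abs_nestedAVaR_sub_le (hY : Integrable Y P) (hZ : Integrable Z Q)
    (h : ∀ᶠ z in ae P ×ˢ ae Q, ENNReal.ofReal |Y z.1 - Z z.2| ≤ ENNReal.ofReal L * c z.1 z.2)
    (hα : ∀ t, α t ∈ Set.Ico (0 : ℝ) 1) (hr : 1 ≤ r) :
    ENNReal.ofReal |nestedAVaR α P Y - nestedAVaR α Q Z|
      ≤ ENNReal.ofReal (L / ∏ t, (1 - α t)) * nestedCost r c P Q := by
  induction T generalizing L with
  | zero =>
    obtain ⟨⟨x, y⟩, hxy⟩ := h.exists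
    rw [Subsingleton.elim x fun t => t.elim0, Subsingleton.elim y fun t => t.elim0] at hxy
    simpa [nestedAVaR, nestedCost] using hxy
  | succ n ih =>
    obtain ⟨hα0, hα1⟩ := hα (Fin.last n)
    rw [nestedAVaR, nestedAVaR, nestedCost, Fin.prod_univ_castSucc,
      mul_comm (∏ t : Fin n, _), ← div_div]
    refine ih (integrable_AVaR_lastKernel hα0 hα1 hY) (integrable_AVaR_lastKernel hα0 hα1 hZ)
      ?_ fun t => hα t.castSucc
    filter_upwards [(ae_integrable_lastKernel hY).prod_mk (ae_integrable_lastKernel hZ),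
      eventually_ae_prod_ae_lastKernel h] with z hz hcost
    exact ofReal_abs_AVaR_sub_le_wasserstein hα0 hα1 hr hz.1 hz.2 hcost

theorem mainTheorem9_general (hY : Integrable Y P) (hZ : Integrable Z Q)
    (h : ∀ᶠ z in ae P ×ˢ ae Q, ENNReal.ofReal |Y z.1 - Z z.2| ≤ ENNReal.ofReal L * c z.1 z.2)
    (hα : ∀ t, α t ∈ Set.Icc (0 : ℝ) 1) {a : ℝ} (ha : 1 - ∏ t, (1 - α t) ≤ a) (ha1 : a < 1)
    (hr : 1 ≤ r) :
    ENNReal.ofReal |nestedAVaR α P Y - nestedAVaR α Q Z|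
      ≤ ENNReal.ofReal (L / (1 - a)) * nestedCost r c P Q := by
  have hprod : 0 < ∏ t, (1 - α t) := by linarith
  have hα1 : ∀ t, α t ≠ 1 := fun t ht =>
    hprod.ne' (Finset.prod_eq_zero (Finset.mem_univ t) (sub_eq_zero.2 ht.symm))
  refine (ofReal_abs_nestedAVaR_sub_le hY hZ h
    (fun t => ⟨(hα t).1, (hα t).2.lt_of_ne (hα1 t)⟩) hr).trans ?_
  rw [ENNReal.ofReal_div_of_pos hprod, ENNReal.ofReal_div_of_pos (sub_pos.2 ha1)]
  gcongr
  linarith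

end NestedAVaR

theorem mainTheorem9 {T : ℕ} (Ξ : Fin T → Type u)
    [∀ t, TopologicalSpace (Ξ t)] [∀ t, PolishSpace (Ξ t)] [∀ t, Nonempty (Ξ t)]
    [∀ t, MeasurableSpace (Ξ t)] [∀ t, BorelSpace (Ξ t)]
    (m : MetricSpace (∀ t, Ξ t))
    (hm : m.toUniformSpace.toTopologicalSpace = Pi.topologicalSpace)
    (P Q : Measure (∀ t, Ξ t)) [IsProbabilityMeasure P] [IsProbabilityMeasure Q]
    (Y : (∀ t, Ξ t) → ℝ) (L : ℝ) (hL : 0 ≤ L)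
    (hY : ∀ x y, |Y x - Y y| ≤ L * m.dist x y)
    (hYP : Integrable Y P) (hYQ : Integrable Y Q)
    (α : Fin T → ℝ) (hα : ∀ t, α t ∈ Set.Icc (0 : ℝ) 1)
    (a : ℝ) (ha : 1 - ∏ t, (1 - α t) ≤ a) (ha1 : a < 1)
    (r : ℝ) (hr : 1 ≤ r) :
    ENNReal.ofReal |nestedAVaR α P Y - nestedAVaR α Q Y|
      ≤ ENNReal.ofReal (L / (1 - a)) * nestedDist r m.dist P Q := by
  refine mainTheorem9_general hYP hYQ (.of_forall fun z => ?_) hα ha ha1 hr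
  exact (ENNReal.ofReal_le_ofReal (hY z.1 z.2)).trans_eq (ENNReal.ofReal_mul hL)
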